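/- Let $F$ be a field and let $D$ be a central division algebra over $F$, that is, a division ring whose center is $F$ and which is finite-dimensional as a vector space over $F$. Then there exist nonzero elements $x,y\in D$ such that $F(xyx^{-1}y^{-1})$, the smallest division subring of $D$ containing $F$ and $xyx^{-1}y^{-1}$, is a maximal subfield of $D$ (that is, it is commutative and is not properly contained in any commutative division subring of $D$). -/

import Mathlib

/-- `F(c)`: the smallest division subring of the division `F`-algebra `D` that contains (the image
of) `F` and the element `c`. (Mathlib's `Subfield D`, for a division ring `D`, is the type of
division subrings of `D`; commutativity is not part of it.) -/
def generatedSubfield (F : Type*) {D : Type*} [Field F] [DivisionRing D] [Algebra F D] (c : D) :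
    Subfield D :=
  Subfield.closure (Set.range (algebraMap F D) ∪ {c})

/-- `K` is a maximal subfield of the division ring `D`: it is commutative (that is, a field), and
no commutative division subring of `D` contains it properly. -/
def IsMaximalSubfield {D : Type*} [DivisionRing D] (K : Subfield D) : Prop :=
  Maximal (fun L : Subfield D => ∀ a ∈ L, ∀ b ∈ L, a * b = b * a) K

open scoped TensorProduct Matrix

/-! ### Maximality from a centralizer condition -/

section MaximalSubfield

variable {F D : Type*} [Field F] [DivisionRing D] [Algebra F D]

/-! It suffices that the centralizer of the commutator `c` is `F[c]`. For finite `F`, Wedderburn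
makes `D` commutative and the claim is trivial. For infinite `F`, let `E` be an algebraic closure;
simplicity of `E ⊗ D` gives `E ⊗ D ≅ Mₙ(E)`. There a matrix with a cyclic vector commutes only with
its polynomials, and membership in `F[c]` descends from `E` to `F`. Cyclicity of the all-ones vector
is the nonvanishing of a Krylov determinant. With adjugates in place of inverses this is a
polynomial condition on the coordinates of `x` and `y`, so one solution over `E` forces one over
`F`. The solution is a diagonal matrix paired with a cyclic permutation. -/

theorem isMaximalSubfield_generatedSubfield_of_centralizer {c : D}
    (h : ∀ z : D, z * c = c * z → z ∈ Algebra.adjoin F {c}) :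
    IsMaximalSubfield (generatedSubfield F c) := by
  have hc : c ∈ generatedSubfield F c := Subfield.subset_closure (Or.inr rfl)
  have hadj : ∀ z ∈ Algebra.adjoin F {c}, z ∈ generatedSubfield F c := by
    intro z hz
    induction hz using Algebra.adjoin_induction with
    | mem x hx => rwa [Set.mem_singleton_iff.mp hx]
    | algebraMap r => exact Subfield.subset_closure (Or.inl ⟨r, rfl⟩)
    | add x y _ _ hx hy => exact add_mem hx hy
    | mul x y _ _ hx hy => exact mul_mem hx hy
  have hcomm : ∀ z ∈ generatedSubfield F c, Commute z c := by
    intro z hz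
    induction hz using Subfield.closure_induction with
    | mem x hx =>
      rcases hx with ⟨r, rfl⟩ | hx
      · exact Algebra.commutes r c
      · rw [Set.mem_singleton_iff.mp hx]
    | one => exact Commute.one_left c
    | add x y _ _ hx hy => exact hx.add_left hy
    | neg x _ hx => exact hx.neg_left
    | inv x _ hx => exact hx.inv_left₀
    | mul x y _ _ hx hy => exact hx.mul_left hy
  -- A commutative division subring containing `c` centralizes `c`, hence lies in `F[c]`.
  refine ⟨fun a ha b hb ↦ ?_, fun L hL hle z hz ↦ hadj z (h z (hL z hz c (hle hc)))⟩
  exact Algebra.commute_of_mem_adjoin_singleton_of_commute (h b (hcomm b hb)) (hcomm a ha)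

end MaximalSubfield

/-! ### Simplicity after scalar extension -/

section Simple

variable {F D E : Type*} [Field F] [DivisionRing D] [Algebra F D] [Field E] [Algebra F E]
  {κ : Type*} [DecidableEq κ] (b : Module.Basis κ F E)

theorem equivFinsuppOfBasisLeft_one_tmul_mul (d : D) (u : E ⊗[F] D) (k : κ) :
    TensorProduct.equivFinsuppOfBasisLeft b (((1 : E) ⊗ₜ[F] d) * u) k =
      d * TensorProduct.equivFinsuppOfBasisLeft b u k := by
  induction u using TensorProduct.induction_on with
  | zero => simp
  | tmul e x => simp
  | add x y hx hy => simp only [mul_add, map_add, Finsupp.add_apply, hx, hy]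

theorem equivFinsuppOfBasisLeft_mul_one_tmul (d : D) (u : E ⊗[F] D) (k : κ) :
    TensorProduct.equivFinsuppOfBasisLeft b (u * ((1 : E) ⊗ₜ[F] d)) k =
      TensorProduct.equivFinsuppOfBasisLeft b u k * d := by
  induction u using TensorProduct.induction_on with
  | zero => simp
  | tmul e x => simp
  | add x y hx hy => simp only [add_mul, map_add, Finsupp.add_apply, hx, hy]

variable (F D E) in
/-- Extending the scalars of a central division algebra to a field gives a simple ring. -/
theorem isSimpleRing_tensorProduct_of_isCentral [Algebra.IsCentral F D] :
    IsSimpleRing (E ⊗[F] D) := by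
  classical
  let b := Module.Basis.ofVectorSpace F E
  let φ := TensorProduct.equivFinsuppOfBasisLeft (N := D) b
  refine .of_eq_bot_or_eq_top fun J ↦ ?_
  -- Descent on the number of nonzero coordinates. Once a coordinate is normalized to `1`, a
  -- commutator with `1 ⊗ d` loses it. If all these commutators vanish, the coordinates are central
  -- and the element is a unit `e ⊗ 1`.
  have key : ∀ m : ℕ, ∀ u ∈ J, u ≠ 0 → (φ u).support.card = m → (1 : E ⊗[F] D) ∈ J := by
    intro m
    induction m using Nat.strong_induction_on with
    | _ m ih =>
    intro u huJ hu hm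
    obtain ⟨k, hk⟩ : ∃ k, φ u k ≠ 0 := by
      by_contra! h
      exact hu (φ.injective (by ext k; simp [h k]))
    set v := ((1 : E) ⊗ₜ[F] (φ u k)⁻¹) * u with hv
    have hvJ : v ∈ J := J.mul_mem_left _ _ huJ
    have hvc : ∀ j, φ v j = (φ u k)⁻¹ * φ u j :=
      equivFinsuppOfBasisLeft_one_tmul_mul b _ u
    have hvk : φ v k = 1 := by rw [hvc, inv_mul_cancel₀ hk]
    by_cases hcen : ∀ d : D, ((1 : E) ⊗ₜ[F] d) * v = v * ((1 : E) ⊗ₜ[F] d)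
    · have hr : ∀ j, ∃ r : F, algebraMap F D r = φ v j := by
        intro j
        have : φ v j ∈ Subalgebra.center F D := by
          rw [Subalgebra.mem_center_iff]
          intro d
          have := congrArg (fun w ↦ φ w j) (hcen d)
          simpa only [φ, equivFinsuppOfBasisLeft_one_tmul_mul,
            equivFinsuppOfBasisLeft_mul_one_tmul] using this
        exact Algebra.mem_bot.mp (Algebra.IsCentral.out this)
      choose r hr using hr
      set e : E := ∑ j ∈ (φ v).support, r j • b j with he
      have hve : v = e ⊗ₜ[F] (1 : D) := by
        rw [← φ.symm_apply_apply v, TensorProduct.equivFinsuppOfBasisLeft_symm_apply, he,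
          TensorProduct.sum_tmul, Finsupp.sum]
        refine Finset.sum_congr rfl fun j _ ↦ ?_
        rw [← hr j, TensorProduct.smul_tmul, Algebra.algebraMap_eq_smul_one]
      have he0 : e ≠ 0 := by
        intro h0
        rw [h0, TensorProduct.zero_tmul] at hve
        rw [hve] at hvk
        simp at hvk
      have := J.mul_mem_left (e⁻¹ ⊗ₜ[F] (1 : D)) v hvJ
      rwa [hve, Algebra.TensorProduct.tmul_mul_tmul, inv_mul_cancel₀ he0, one_mul,
        ← Algebra.TensorProduct.one_def] at this
    · push Not at hcen
      obtain ⟨d, hd⟩ := hcen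
      set w := ((1 : E) ⊗ₜ[F] d) * v - v * ((1 : E) ⊗ₜ[F] d) with hw
      have hwc : ∀ j, φ w j = d * φ v j - φ v j * d := by
        intro j
        simp only [hw, map_sub, Finsupp.sub_apply, φ, equivFinsuppOfBasisLeft_one_tmul_mul,
          equivFinsuppOfBasisLeft_mul_one_tmul]
      refine ih _ ?_ w (J.sub_mem (J.mul_mem_left _ _ hvJ) (J.mul_mem_right _ _ hvJ))
        (sub_ne_zero.mpr hd) rfl
      rw [← hm]
      refine Finset.card_lt_card (Finset.ssubset_iff_of_subset ?_ |>.mpr ⟨k, ?_, ?_⟩)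
      · intro j hj
        rw [Finsupp.mem_support_iff] at hj ⊢
        intro h0
        exact hj (by rw [hwc, hvc, h0]; simp)
      · simpa using hk
      · simp [hwc, hvk]
  by_cases h : ∃ u ∈ J, u ≠ 0
  · obtain ⟨u, huJ, hu⟩ := h
    exact Or.inr (J.one_mem_iff.mp (key _ u huJ hu rfl))
  · push Not at h
    refine Or.inl (le_bot_iff.mp fun u hu ↦ ?_)
    rw [h u hu]
    exact TwoSidedIdeal.zero_mem _

end Simple

/-! ### Cyclic vectors and Krylov matrices -/

section Krylov

/-- The matrix whose columns are `w ^ j` applied to the all-ones vector. -/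
def krylov {R : Type*} [CommRing R] {n : ℕ} (w : Matrix (Fin n) (Fin n) R) :
    Matrix (Fin n) (Fin n) R :=
  Matrix.of fun i j ↦ ((w ^ (j : ℕ)) *ᵥ 1) i

variable {R : Type*} [CommRing R] {n : ℕ}

theorem krylov_map {S : Type*} [CommRing S] (f : R →+* S) (w : Matrix (Fin n) (Fin n) R) :
    f.mapMatrix (krylov w) = krylov (f.mapMatrix w) := by
  ext i j
  rw [krylov, krylov, Matrix.of_apply, ← map_pow]
  simp [Matrix.mulVec, dotProduct]

theorem krylov_smul (a : R) (w : Matrix (Fin n) (Fin n) R) :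
    krylov (a • w) = krylov w * Matrix.diagonal fun j : Fin n ↦ a ^ (j : ℕ) := by
  ext i j
  simp [krylov, smul_pow, Matrix.smul_mulVec, mul_comm]

theorem krylov_diagonal (v : Fin n → R) :
    krylov (Matrix.diagonal v) = Matrix.vandermonde v := by
  ext i j
  simp [krylov, Matrix.diagonal_pow, Matrix.mulVec_diagonal, Matrix.vandermonde]

variable {E : Type*} [Field E]

theorem det_krylov_smul_ne_zero_iff {a : E} (ha : a ≠ 0) (w : Matrix (Fin n) (Fin n) E) :
    (krylov (a • w)).det ≠ 0 ↔ (krylov w).det ≠ 0 := by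
  rw [krylov_smul, Matrix.det_mul, Matrix.det_diagonal]
  simp [Finset.prod_eq_zero_iff, ha]

/-- A matrix for which the all-ones vector is cyclic commutes only with its polynomials. -/
theorem mem_adjoin_of_commute_of_det_krylov_ne_zero {w z : Matrix (Fin n) (Fin n) E}
    (hw : (krylov w).det ≠ 0) (hz : Commute z w) : z ∈ Algebra.adjoin E {w} := by
  have hu : IsUnit (krylov w).det := isUnit_iff_ne_zero.mpr hw
  set a := (krylov w)⁻¹ *ᵥ (z *ᵥ 1) with ha
  -- `a` holds the coordinates of `z *ᵥ 1` in the Krylov basis, so the polynomial `p` in `w` agrees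
  -- with `z` on the all-ones vector.
  have hka : krylov w *ᵥ a = z *ᵥ 1 := by
    rw [ha, Matrix.mulVec_mulVec, Matrix.mul_nonsing_inv _ hu, Matrix.one_mulVec]
  set p := ∑ j : Fin n, a j • w ^ (j : ℕ) with hp
  have hpmem : p ∈ Algebra.adjoin E {w} :=
    sum_mem fun j _ ↦ Subalgebra.smul_mem _
      (pow_mem (Algebra.subset_adjoin (Set.mem_singleton w)) _) _
  have hpone : p *ᵥ 1 = z *ᵥ 1 := by
    rw [← hka, hp, Matrix.sum_mulVec]
    ext i
    simp only [Finset.sum_apply, Matrix.smul_mulVec, Pi.smul_apply, smul_eq_mul]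
    rw [Matrix.mulVec, dotProduct]
    exact Finset.sum_congr rfl fun j _ ↦ mul_comm _ _
  have hpw : Commute p w :=
    (Algebra.commute_of_mem_adjoin_singleton_of_commute hpmem (Commute.refl w)).symm
  have hkill : (z - p) * krylov w = 0 := by
    ext i j
    have h1 : (z - p) *ᵥ (w ^ (j : ℕ) *ᵥ 1) = 0 := by
      rw [Matrix.mulVec_mulVec, ((hz.sub_left hpw).pow_right _).eq, ← Matrix.mulVec_mulVec,
        Matrix.sub_mulVec, hpone, sub_self, Matrix.mulVec_zero]
    exact congrFun h1 i
  have : z - p = 0 := by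
    rw [← Matrix.mul_nonsing_inv_cancel_right (A := krylov w) (z - p) hu, hkill, zero_mul]
  rwa [sub_eq_zero.mp this]

end Krylov

/-! ### A good commutator over `E`, then over `F` -/

section Existence

/-- The bound `N` matters: over the algebraic closure of a finite field every nonzero `t` is a root
of unity. -/
theorem exists_pow_injOn (E : Type*) [Field E] [Infinite E] (N : ℕ) :
    ∃ t : E, t ≠ 0 ∧ ∀ k ≤ N, ∀ l ≤ N, t ^ k = t ^ l → k = l := by
  obtain ⟨t, ht⟩ : ∃ t : E, (Polynomial.X *
      ∏ k ∈ Finset.range N, (Polynomial.X ^ (k + 1) - 1) : Polynomial E).eval t ≠ 0 := by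
    by_contra! h
    have h0 := Polynomial.funext (q := 0) fun t ↦ (h t).trans Polynomial.eval_zero.symm
    rw [mul_eq_zero, Finset.prod_eq_zero_iff] at h0
    rcases h0 with h0 | ⟨k, -, h0⟩
    · exact Polynomial.X_ne_zero h0
    · exact Polynomial.X_pow_sub_C_ne_zero (Nat.succ_pos k) (1 : E) (by simpa using h0)
  rw [Polynomial.eval_mul, Polynomial.eval_prod, mul_ne_zero_iff, Finset.prod_ne_zero_iff] at ht
  obtain ⟨ht0, ht1⟩ := ht
  simp only [Polynomial.eval_X] at ht0
  have hlt : ∀ k l, k < l → l ≤ N → t ^ k ≠ t ^ l := by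
    intro k l hkl hl h
    obtain ⟨m, rfl⟩ := Nat.exists_eq_add_of_lt hkl
    refine ht1 m (Finset.mem_range.mpr (by omega)) ?_
    rw [add_assoc, pow_add] at h
    have := mul_left_cancel₀ (pow_ne_zero k ht0) ((mul_one _).trans h)
    simp [← this]
  refine ⟨t, ht0, fun k hk l hl h ↦ ?_⟩
  rcases lt_trichotomy k l with hkl | hkl | hkl
  · exact absurd h (hlt k l hkl hl)
  · exact hkl
  · exact absurd h.symm (hlt l k hkl hk)

/-- Some commutator of a diagonal matrix and a cyclic permutation matrix has the all-ones vector
as a cyclic vector. -/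
theorem exists_det_krylov_commutator_ne_zero (E : Type*) [Field E] [Infinite E] (n : ℕ) :
    ∃ x y x' y' : Matrix (Fin n) (Fin n) E, x * x' = 1 ∧ y * y' = 1 ∧
      (krylov (x * y * x' * y')).det ≠ 0 := by
  obtain ⟨t, ht0, ht⟩ := exists_pow_injOn E (2 * n ^ 2)
  set σ := finRotate n with hσ
  -- With squares as exponents, `d i / d (σ i)` is `t ^ (-(2 * i + 1))`, except `t ^ ((n - 1) ^ 2)`
  -- at the last index; these exponents are distinct.
  let d : Fin n → E := fun i ↦ t ^ ((i : ℕ) ^ 2)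
  have hd : ∀ i, d i ≠ 0 := fun i ↦ pow_ne_zero _ ht0
  refine ⟨Matrix.diagonal d, σ.permMatrix E, Matrix.diagonal fun i ↦ (d i)⁻¹,
    (σ⁻¹).permMatrix E, ?_, ?_, ?_⟩
  · rw [Matrix.diagonal_mul_diagonal, ← Matrix.diagonal_one]
    congr 1
    ext i
    exact mul_inv_cancel₀ (hd i)
  · rw [← Matrix.permMatrix_mul, inv_mul_cancel, Matrix.permMatrix_one]
  · have hW : Matrix.diagonal d * σ.permMatrix E * Matrix.diagonal (fun i ↦ (d i)⁻¹) *
        (σ⁻¹).permMatrix E = Matrix.diagonal fun i ↦ d i * (d (σ i))⁻¹ := by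
      rw [mul_assoc, mul_assoc, Equiv.Perm.permMatrix, Equiv.Perm.permMatrix,
        PEquiv.mul_toMatrix_toPEquiv, PEquiv.toMatrix_toPEquiv_mul]
      ext i j
      simp only [Matrix.diagonal_mul, Matrix.submatrix_apply, Matrix.diagonal_apply,
        Equiv.Perm.inv_def, Equiv.symm_symm, id, EmbeddingLike.apply_eq_iff_eq]
      by_cases h : i = j <;> simp [h]
    rw [hW, krylov_diagonal, Matrix.det_vandermonde_ne_zero_iff]
    intro i j hij
    have hij : d i * d (σ j) = d j * d (σ i) := by
      have h1 := hd (σ i)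
      have h2 := hd (σ j)
      simp only at hij
      field_simp at hij
      rw [hij, mul_comm]
    simp only [d, ← pow_add] at hij
    have hle : ∀ k : Fin n, (k : ℕ) ^ 2 ≤ n ^ 2 := fun k ↦ Nat.pow_le_pow_left k.2.le 2
    have h1 := hle i
    have h2 := hle j
    have h3 := hle (σ i)
    have h4 := hle (σ j)
    have hexp := ht _ (by omega) _ (by omega) hij
    obtain ⟨m, rfl⟩ : ∃ m, n = m + 1 := ⟨n - 1, by have := i.2; omega⟩
    have hval : ∀ k : Fin (m + 1), ((σ k : Fin (m + 1)) : ℕ) =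
        if (k : ℕ) = m then 0 else (k : ℕ) + 1 := by
      intro k
      rw [hσ, coe_finRotate]
      simp [Fin.ext_iff]
    rw [hval, hval] at hexp
    ext
    have hi := i.2
    have hj := j.2
    split_ifs at hexp <;> nlinarith

/-- If the matrices `B k` span the matrix algebra over `E`, and `F` is an infinite subfield of `E`,
then two `F`-combinations of them have a commutator with the all-ones vector as cyclic vector. -/
theorem exists_algebraMap_det_krylov_ne_zero {F E : Type*} [Field F] [Field E] [Algebra F E]
    [Infinite F] {n : ℕ} {κ : Type*} [Fintype κ] (B : κ → Matrix (Fin n) (Fin n) E)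
    (hB : ∀ M, ∃ t : κ → E, M = ∑ k, t k • B k) :
    ∃ s s' : κ → F, ∃ x y : Matrix (Fin n) (Fin n) E,
      x = ∑ k, algebraMap F E (s k) • B k ∧ y = ∑ k, algebraMap F E (s' k) • B k ∧
      x.det ≠ 0 ∧ y.det ≠ 0 ∧ (krylov (x * y * x.adjugate * y.adjugate)).det ≠ 0 := by
  have : Infinite E := Infinite.of_injective _ (algebraMap F E).injective
  let G (f : κ → κ ⊕ κ) : Matrix (Fin n) (Fin n) (MvPolynomial (κ ⊕ κ) E) :=
    ∑ k, (MvPolynomial.X (f k) : MvPolynomial (κ ⊕ κ) E) • (MvPolynomial.C.mapMatrix (B k))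
  have hG : ∀ (f : κ → κ ⊕ κ) (v : κ ⊕ κ → E),
      (MvPolynomial.eval v).mapMatrix (G f) = ∑ k, v (f k) • B k := by
    intro f v
    ext i j
    simp [G, Matrix.sum_apply]
  let X := G Sum.inl
  let Y := G Sum.inr
  -- The determinant factors force invertibility; an adjugate differs from the inverse by a scalar,
  -- which does not affect cyclicity.
  let P := X.det * Y.det * (krylov (X * Y * X.adjugate * Y.adjugate)).det
  have hP : ∀ v : κ ⊕ κ → E, MvPolynomial.eval v P =
      (∑ k, v (Sum.inl k) • B k).det * (∑ k, v (Sum.inr k) • B k).det *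
      (krylov ((∑ k, v (Sum.inl k) • B k) * (∑ k, v (Sum.inr k) • B k) *
        (∑ k, v (Sum.inl k) • B k).adjugate * (∑ k, v (Sum.inr k) • B k).adjugate)).det := by
    intro v
    simp only [P, X, Y, map_mul, RingHom.map_det, krylov_map, RingHom.map_adjugate, hG]
  have hP0 : P ≠ 0 := by
    intro h0
    obtain ⟨x, y, x', y', hx, hy, hk⟩ := exists_det_krylov_commutator_ne_zero E n
    obtain ⟨t, rfl⟩ := hB x
    obtain ⟨t', rfl⟩ := hB y
    have hev := hP (Sum.elim t t')
    simp only [h0, map_zero, Sum.elim_inl, Sum.elim_inr] at hev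
    set x := ∑ k, t k • B k
    set y := ∑ k, t' k • B k
    have hadj : ∀ {a a' : Matrix (Fin n) (Fin n) E}, a * a' = 1 →
        a.det ≠ 0 ∧ a.adjugate = a.det • a' := by
      intro a a' h
      refine ⟨fun h0 ↦ ?_, ?_⟩
      · have := congrArg Matrix.det h
        simp [h0] at this
      · rw [← mul_one a.adjugate, ← h, ← mul_assoc, Matrix.adjugate_mul, Matrix.smul_mul, one_mul]
    obtain ⟨hx0, hx1⟩ := hadj hx
    obtain ⟨hy0, hy1⟩ := hadj hy
    rw [hx1, hy1, Matrix.mul_smul, Matrix.mul_smul, Matrix.smul_mul] at hev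
    refine mul_ne_zero (mul_ne_zero hx0 hy0) ?_ hev.symm
    rwa [det_krylov_smul_ne_zero_iff hy0, det_krylov_smul_ne_zero_iff hx0]
  obtain ⟨v, hv, hne⟩ : ∃ v ∈ Set.pi Set.univ fun _ : κ ⊕ κ ↦ Set.range (algebraMap F E),
      MvPolynomial.eval v P ≠ 0 := by
    by_contra! h
    exact hP0 (MvPolynomial.funext_set _
      (fun _ ↦ Set.infinite_range_of_injective (algebraMap F E).injective)
      fun v hv ↦ (h v hv).trans (map_zero _).symm)
  choose s hs using fun i ↦ hv i (Set.mem_univ i)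
  rw [hP] at hne
  simp only [← hs] at hne
  rw [mul_ne_zero_iff, mul_ne_zero_iff] at hne
  exact ⟨_, _, _, _, rfl, rfl, hne.1.1, hne.1.2, hne.2⟩

end Existence

/-- Membership in the subalgebra generated by one element descends along field extensions. -/
theorem mem_adjoin_singleton_of_one_tmul_mem {F D E : Type*} [Field F] [Ring D] [Algebra F D]
    [Field E] [Algebra F E] {c z : D}
    (h : (1 : E) ⊗ₜ[F] z ∈ Algebra.adjoin E {(1 : E) ⊗ₜ[F] c}) : z ∈ Algebra.adjoin F {c} := by
  set A := Algebra.adjoin F {c} with hA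
  have hle : Algebra.adjoin E {(1 : E) ⊗ₜ[F] c} ≤ A.baseChange E :=
    Algebra.adjoin_le (Set.singleton_subset_iff.mpr
      (Subalgebra.tmul_mem_baseChange (Algebra.subset_adjoin (Set.mem_singleton c)) 1))
  obtain ⟨u, hu⟩ := hle h
  by_contra hz
  -- A functional that kills `A` but not `z` still separates them after base change.
  obtain ⟨f, hfz, hf⟩ := Submodule.exists_le_ker_of_notMem
    (p := Subalgebra.toSubmodule A) (v := z) hz
  have hzero : ∀ u : E ⊗[F] A,
      f.baseChange E (Algebra.TensorProduct.map (AlgHom.id E E) A.val u) = 0 := by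
    intro u
    induction u using TensorProduct.induction_on with
    | zero => simp
    | tmul e x =>
      have : f x = 0 := hf x.2
      simp [this]
    | add x y hx hy => rw [map_add, map_add, hx, hy, add_zero]
  have h0 : f.baseChange E ((1 : E) ⊗ₜ[F] z) = 0 := by
    rw [← hu]
    exact hzero u
  rw [LinearMap.baseChange_tmul] at h0
  have := congrArg (TensorProduct.rid F E) h0
  simp [hfz] at this

theorem exists_commutator_centralizer_le_adjoin (F : Type*) (D : Type*) [Field F] [DivisionRing D]
    [Algebra F D] [Algebra.IsCentral F D] [FiniteDimensional F D] [Infinite F] :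
    ∃ x y : D, x ≠ 0 ∧ y ≠ 0 ∧ ∀ z : D, z * (x * y * x⁻¹ * y⁻¹) = x * y * x⁻¹ * y⁻¹ * z →
      z ∈ Algebra.adjoin F {x * y * x⁻¹ * y⁻¹} := by
  let E := AlgebraicClosure F
  have : IsSimpleRing (E ⊗[F] D) := isSimpleRing_tensorProduct_of_isCentral F D E
  obtain ⟨n, hn, ⟨e⟩⟩ := IsSimpleRing.exists_algEquiv_matrix_of_isAlgClosed E (E ⊗[F] D)
  let φ : D →+* Matrix (Fin n) (Fin n) E :=
    (e : (E ⊗[F] D) →+* Matrix (Fin n) (Fin n) E).comp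
      (Algebra.TensorProduct.includeRight : D →ₐ[F] E ⊗[F] D).toRingHom
  have hφ : ∀ d, φ d = e ((1 : E) ⊗ₜ[F] d) := fun _ ↦ rfl
  let b := Module.finBasis F D
  have hcomb : ∀ s : Fin (Module.finrank F D) → F,
      ∑ k, algebraMap F E (s k) • φ (b k) = φ (∑ k, s k • b k) := by
    intro s
    rw [map_sum]
    refine Finset.sum_congr rfl fun k _ ↦ ?_
    rw [hφ, hφ, ← map_smul, TensorProduct.smul_tmul', TensorProduct.tmul_smul,
      TensorProduct.smul_tmul', smul_eq_mul,
      Algebra.smul_def, mul_one]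
  obtain ⟨s, s', X, Y, hX, hY, hX0, hY0, hk⟩ :=
    exists_algebraMap_det_krylov_ne_zero (F := F) (fun k ↦ φ (b k)) (fun M ↦ by
      refine ⟨(b.baseChange E).repr (e.symm M), ?_⟩
      conv_lhs => rw [← e.apply_symm_apply M, ← (b.baseChange E).sum_repr (e.symm M)]
      rw [map_sum]
      refine Finset.sum_congr rfl fun k _ ↦ ?_
      rw [map_smul, Module.Basis.baseChange_apply, hφ])
  rw [hcomb] at hX hY
  set x := ∑ k, s k • b k
  set y := ∑ k, s' k • b k
  have hadj : ∀ a : D, (φ a).det ≠ 0 →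
      a ≠ 0 ∧ (φ a).adjugate = (φ a).det • φ a⁻¹ := by
    intro a ha
    have ha0 : a ≠ 0 := by
      rintro rfl
      rw [map_zero, Matrix.det_zero] at ha
      exact ha rfl
    refine ⟨ha0, ?_⟩
    rw [← mul_one (φ a).adjugate, ← map_one φ, ← mul_inv_cancel₀ ha0, map_mul, ← mul_assoc,
      Matrix.adjugate_mul, Matrix.smul_mul, one_mul]
  obtain ⟨hx0, hx1⟩ := hadj x (hX ▸ hX0)
  obtain ⟨hy0, hy1⟩ := hadj y (hY ▸ hY0)
  refine ⟨x, y, hx0, hy0, fun z hz ↦ ?_⟩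
  rw [hX, hY, hx1, hy1, Matrix.mul_smul, Matrix.mul_smul, Matrix.smul_mul,
    det_krylov_smul_ne_zero_iff (hY ▸ hY0), det_krylov_smul_ne_zero_iff (hX ▸ hX0),
    ← map_mul, ← map_mul, ← map_mul] at hk
  have hmem := mem_adjoin_of_commute_of_det_krylov_ne_zero hk
    (show Commute (φ z) _ from by rw [Commute, SemiconjBy, ← map_mul, ← map_mul, hz])
  refine mem_adjoin_singleton_of_one_tmul_mem (E := E) ?_
  have := Subalgebra.mem_map (f := (e.symm : _ →ₐ[E] E ⊗[F] D)) |>.mpr ⟨_, hmem, (e.symm_apply_apply ((1 : E) ⊗ₜ[F] z))⟩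
  rwa [AlgHom.map_adjoin, Set.image_singleton, hφ, AlgEquiv.coe_toAlgHom,
    e.symm_apply_apply] at this

theorem theorem3p2 (F : Type*) (D : Type*) [Field F] [DivisionRing D] [Algebra F D]
    [Algebra.IsCentral F D] [FiniteDimensional F D] :
    ∃ x y : D, x ≠ 0 ∧ y ≠ 0 ∧
      IsMaximalSubfield (generatedSubfield F (x * y * x⁻¹ * y⁻¹)) := by
  rcases finite_or_infinite F with hF | hF
  · have : Finite D := Module.finite_of_finite F
    -- Here `D` is commutative, so it equals its center `F` and any commutator works.
    refine ⟨1, 1, one_ne_zero, one_ne_zero,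
      isMaximalSubfield_generatedSubfield_of_centralizer fun z _ ↦ ?_⟩
    have hz : z ∈ Subalgebra.center F D :=
      Subalgebra.mem_center_iff.mpr fun d ↦ (littleWedderburn D).mul_comm d z
    exact bot_le (a := Algebra.adjoin F _) (Algebra.IsCentral.out hz)
  · obtain ⟨x, y, hx, hy, h⟩ := exists_commutator_centralizer_le_adjoin F D
    exact ⟨x, y, hx, hy, isMaximalSubfield_generatedSubfield_of_centralizer h⟩
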